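/- For a positive integer $k$ write $[k]=\{1,\dots,k\}$. Let $m,n$ be positive integers and let $L=([m]\times\{1\})\cup(\{1\}\times[n])$. For a real number $\xi>0$ let $\tau_\xi:[m]\times[n]\to[mn]$ be the map $$\tau_\xi(i,j)=\#\{(s,t)\in[m]\times[n] : s+t\xi\le i+j\xi\}.$$ A Young ranking table of size $(m,n)$ is an injective map of the form $\tau_\xi$ with $\xi>0$. Let $\mathrm{LY}_{m,n}$ be the set of the restrictions $\tau|_L$ of all Young ranking tables $\tau$ of size $(m,n)$. Let $\mathcal{E}^{1,in}_{m,n}$ be the set of injective L-shapes of difference equation type, that is, of all injective maps $f:L\to[mn]$ such that $f(1,1)=1$, $$f(i+1,1)-f(i,1)=\#\{t\in[n] : f(1,t)\le f(i+1,1)\}\quad\text{for } 1\le i\le m-1,$$ $$f(1,j+1)-f(1,j)=\#\{s\in[m] : f(s,1)\le f(1,j+1)\}\quad\text{for } 1\le j\le n-1.$$ For nonnegative integers $m',n'$ let $G_{m',n'}=\{0,\infty\}\cup\{p/q : 1\le p\le m',\ 1\le q\le n'\}$ (so $G_{m',n'}=\{0,\infty\}$ if $m'n'=0$), and let $G^{\mathrm{int}}_{m',n'}$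 be the set of the open intervals $(a,b)$ such that $a<b$ are adjacent elements of $G_{m',n'}$ in increasing order. Then $\mathrm{LY}_{m,n}=\mathcal{E}^{1,in}_{m,n}$, and the common cardinality of these sets is finite and equal to $|G^{\mathrm{int}}_{m-1,n-1}|=|G_{m-1,n-1}|-1$. -/

import Mathlib

open scoped BigOperators

/-- The set `[k] = {1, 2, …, k}`. -/
abbrev seg (k : ℕ) : Set ℕ := Set.Icc 1 k

/-- The rectangle `[m] × [n]`; a point is `(i, j)` with `i` the horizontal and `j` the vertical
index. -/
def rect (m n : ℕ) : Set (ℕ × ℕ) := seg m ×ˢ seg n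

/-- The L-shaped domain `([m] × {1}) ∪ ({1} × [n])`. -/
def lShape (m n : ℕ) : Set (ℕ × ℕ) := (seg m ×ˢ {1}) ∪ ({1} ×ˢ seg n)

theorem lShape_subset_rect {m n : ℕ} (hm : 0 < m) (hn : 0 < n) : lShape m n ⊆ rect m n := by
  rintro ⟨i, j⟩ h
  simp only [lShape, rect, seg, Set.mem_union, Set.mem_prod, Set.mem_Icc,
    Set.mem_singleton_iff] at h ⊢
  omega

/-- The point `(i, 1)` of the L-shaped domain. -/
def hPoint {m : ℕ} (n : ℕ) (i : seg m) : lShape m n := ⟨(i.1, 1), Or.inl ⟨i.2, rfl⟩⟩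

/-- The point `(1, j)` of the L-shaped domain. -/
def vPoint (m : ℕ) {n : ℕ} (j : seg n) : lShape m n := ⟨(1, j.1), Or.inr ⟨rfl, j.2⟩⟩

/-- The difference equations `E_{m,n}` for a map `f : ([m] × {1}) ∪ ({1} × [n]) → [mn]`. In each
half, consecutive indices are written `i, i'` with `i' = i + 1`. -/
def SatisfiesE (m n : ℕ) (f : lShape m n → seg (m * n)) : Prop :=
  (∀ i i' : seg m, (i' : ℕ) = i + 1 →
    ((f (hPoint n i') : ℕ) : ℤ) - ((f (hPoint n i) : ℕ) : ℤ) =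
      ∑ t : seg n, if (f (vPoint m t) : ℕ) ≤ (f (hPoint n i') : ℕ) then 1 else 0) ∧
  (∀ j j' : seg n, (j' : ℕ) = j + 1 →
    ((f (vPoint m j') : ℕ) : ℤ) - ((f (vPoint m j) : ℕ) : ℤ) =
      ∑ s : seg m, if (f (hPoint n s) : ℕ) ≤ (f (vPoint m j') : ℕ) then 1 else 0)

/-- The set `ℰ^{1,in}_{m,n}` of injective L-shapes of difference equation type of size `(m, n)`.
It is empty if `m = 0` or `n = 0`. -/
def injLShapes (m n : ℕ) : Set (lShape m n → seg (m * n)) :=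
  {f | Function.Injective f ∧ SatisfiesE m n f ∧
    ∃ h : ((1, 1) : ℕ × ℕ) ∈ lShape m n, (f ⟨(1, 1), h⟩ : ℕ) = 1}

/-- The number of `(s, t) ∈ [m] × [n]` with `s + t ξ ≤ i + j ξ`. -/
noncomputable def rankValue (m n : ℕ) (ξ : ℝ) (i j : ℕ) : ℕ :=
  ∑ s ∈ Finset.Icc 1 m, ∑ t ∈ Finset.Icc 1 n,
    if (s : ℝ) + (t : ℝ) * ξ ≤ (i : ℝ) + (j : ℝ) * ξ then 1 else 0

theorem rankValue_mem {m n : ℕ} (ξ : ℝ) {p : ℕ × ℕ} (hp : p ∈ rect m n) :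
    rankValue m n ξ p.1 p.2 ∈ seg (m * n) := by
  obtain ⟨i, j⟩ := p
  obtain ⟨hi, hj⟩ := hp
  have hi' : i ∈ Finset.Icc 1 m := Finset.mem_Icc.2 hi
  have hj' : j ∈ Finset.Icc 1 n := Finset.mem_Icc.2 hj
  refine Set.mem_Icc.2 ⟨?_, ?_⟩
  · calc 1 = if (i : ℝ) + (j : ℝ) * ξ ≤ (i : ℝ) + (j : ℝ) * ξ then 1 else 0 := by simp
      _ ≤ ∑ t ∈ Finset.Icc 1 n,
          if (i : ℝ) + (t : ℝ) * ξ ≤ (i : ℝ) + (j : ℝ) * ξ then 1 else 0 :=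
        Finset.single_le_sum
          (f := fun t : ℕ => if (i : ℝ) + (t : ℝ) * ξ ≤ (i : ℝ) + (j : ℝ) * ξ then 1 else 0)
          (fun _ _ => Nat.zero_le _) hj'
      _ ≤ rankValue m n ξ i j :=
        Finset.single_le_sum
          (f := fun s : ℕ => ∑ t ∈ Finset.Icc 1 n,
            if (s : ℝ) + (t : ℝ) * ξ ≤ (i : ℝ) + (j : ℝ) * ξ then 1 else 0)
          (fun _ _ => Nat.zero_le _) hi'
  · calc rankValue m n ξ i j ≤ ∑ s ∈ Finset.Icc 1 m, ∑ t ∈ Finset.Icc 1 n, 1 := by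
          refine Finset.sum_le_sum fun s _ => Finset.sum_le_sum fun t _ => ?_
          split_ifs <;> simp
      _ = m * n := by simp

/-- The map `τ_{1,ξ}^{m,n} : [m] × [n] → [mn]`. -/
noncomputable def rankTable (m n : ℕ) (ξ : ℝ) : rect m n → seg (m * n) :=
  fun p => ⟨rankValue m n ξ p.1.1 p.1.2, rankValue_mem ξ p.2⟩

/-- The set `Y_{m,n}` of Young ranking tables of size `(m, n)`. -/
def youngTables (m n : ℕ) : Set (rect m n → seg (m * n)) :=
  {τ | Function.Injective τ ∧ ∃ ξ : ℝ, 0 < ξ ∧ τ = rankTable m n ξ}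

/-- The set `LY_{m,n}` of the restrictions of the Young ranking tables of size `(m, n)` to
`([m] × {1}) ∪ ({1} × [n])`. -/
def youngLShapes (m n : ℕ) (hm : 0 < m) (hn : 0 < n) : Set (lShape m n → seg (m * n)) :=
  {f | ∃ τ ∈ youngTables m n, f = fun p => τ (Set.inclusion (lShape_subset_rect hm hn) p)}

/-- The set `G_{m,n}` of generalized Farey fractions, including `0` and `∞`. -/
def fareySet (m n : ℕ) : Set EReal :=
  if m * n = 0 then {0, ⊤}
  else {0, ⊤} ∪ {x | ∃ p ∈ seg m, ∃ q ∈ seg n, x = (((p : ℝ) / (q : ℝ) : ℝ) : EReal)}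

/-- The set `G_{m,n}^{int}` of the open intervals between two adjacent elements of `G_{m,n}`. -/
def fareyIntervals (m n : ℕ) : Set (Set ℝ) :=
  {I | ∃ a ∈ fareySet m n, ∃ b ∈ fareySet m n, a < b ∧
    (∀ c ∈ fareySet m n, ¬ (a < c ∧ c < b)) ∧
    I = {x : ℝ | a < (x : EReal) ∧ (x : EReal) < b}}

/-!
Write `M = m - 1`, `N = n - 1` and record an L-shape `f` by its arms `a p = f (p + 1, 1)` and
`b q = f (1, q + 1)`. The difference equations say that `a` and `b` are determined by the set `S` of
pairs `(p, q)` in `[1, M] × [1, N]` with `b q < a p`: for example `a p - p - 1` is the number of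
`(k, l) ∈ S` with `k ≤ p`. For a ranking table `τ_ξ` the set `S` consists of the pairs with
`q ξ < p`, and the difference equations hold by telescoping, because each unit interval `(x, x + 1]`
contains exactly one integer.

Conversely, let `a`, `b` solve the equations, and let `T` be the complement of `S`. The point is that
`S` and `T` are separated by the slope `p / q` (`IsArmPair.isSeparated`), so that any `ξ` between the
slopes of `T` and those of `S` gives back `f`. The proof is by induction on `M + N`. The largest value
is `a M` or `b N`, say `a M`, and omitting it leaves a solution, so it remains to show that the slopes
of `T` are less than `M / N`. If `(p, q) ∈ T` had slope at least `M / N`, the point reflection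
`(k, l) ↦ (M - k, N - l)` would map `(p, q)` and all `(k, l) ∈ S` with `k < M` into `T`, where they
miss the `M - 1` pairs `(k, N)`, which also lie in `T`. This makes `T` so large that `a M ≤ b N`, a
contradiction (`IsArmPair.slope_lt`).

Finally, the comparisons made by `τ_ξ` depend only on the gap of the Farey set containing `ξ`, and a
fraction `p / q` between two slopes is witnessed by the values at `(p + 1, 1)` and `(1, q + 1)`. So
both the L-shapes and the gaps are parametrized by the elements of the Farey set other than `∞`.
-/

/-! ### Systems of difference equations for a pair of sequences -/

/-- The difference equations for the two arms `a p = f (p + 1, 1)`, `0 ≤ p ≤ M`, and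
`b q = f (1, q + 1)`, `0 ≤ q ≤ N`, of an injective L-shape of size `(M + 1, N + 1)`. Indices start
at `0` so that the corner is `a 0 = b 0 = 1`. -/
structure IsArmPair (M N : ℕ) (a b : ℕ → ℕ) : Prop where
  left_zero : a 0 = 1
  right_zero : b 0 = 1
  left_succ : ∀ p < M, a (p + 1) = a p + ((Finset.range (N + 1)).filter (b · ≤ a (p + 1))).card
  right_succ : ∀ q < N, b (q + 1) = b q + ((Finset.range (M + 1)).filter (a · ≤ b (q + 1))).card
  ne : ∀ p q, 1 ≤ p → p ≤ M → 1 ≤ q → q ≤ N → a p ≠ b q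

namespace IsArmPair

variable {M N : ℕ} {a b : ℕ → ℕ}

theorem swap (h : IsArmPair M N a b) : IsArmPair N M b a :=
  ⟨h.right_zero, h.left_zero, h.right_succ, h.left_succ,
    fun q p hq hq' hp hp' => (h.ne p q hp hp' hq hq').symm⟩

theorem one_le_left (h : IsArmPair M N a b) : ∀ p ≤ M, 1 ≤ a p
  | 0, _ => h.left_zero.ge
  | p + 1, hp => by
    have := h.one_le_left p (by omega)
    have := h.left_succ p hp
    omega

theorem left_lt_succ (h : IsArmPair M N a b) {p : ℕ} (hp : p < M) : a p < a (p + 1) := by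
  have h1 := h.left_succ p hp
  have : 0 < ((Finset.range (N + 1)).filter (b · ≤ a (p + 1))).card := by
    refine Finset.card_pos.2 ⟨0, ?_⟩
    simp [h.right_zero, h.one_le_left (p + 1) hp]
  omega

theorem left_lt (h : IsArmPair M N a b) {p p' : ℕ} (hpp : p < p') (hp : p' ≤ M) : a p < a p' := by
  induction p', hpp using Nat.le_induction with
  | base => exact h.left_lt_succ hp
  | succ k hk ih => exact (ih (by omega)).trans (h.left_lt_succ hp)

theorem left_le (h : IsArmPair M N a b) {p p' : ℕ} (hpp : p ≤ p') (hp : p' ≤ M) : a p ≤ a p' := by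
  rcases hpp.eq_or_lt with rfl | hlt
  · rfl
  · exact (h.left_lt hlt hp).le

theorem right_le (h : IsArmPair M N a b) {q q' : ℕ} (hqq : q ≤ q') (hq : q' ≤ N) : b q ≤ b q' :=
  h.swap.left_le hqq hq

/-- The count in the difference equation, with the corner split off. -/
theorem card_filter (h : IsArmPair M N a b) {p : ℕ} (hp : 1 ≤ p) (hp' : p ≤ M) :
    ((Finset.range (N + 1)).filter (b · ≤ a p)).card =
      1 + ((Finset.Icc 1 N).filter (b · < a p)).card := by
  have : (Finset.range (N + 1)).filter (b · ≤ a p) =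
      insert 0 ((Finset.Icc 1 N).filter (b · < a p)) := by
    ext q
    have h0 := h.right_zero
    have h1 := h.one_le_left p hp'
    have h2 := h.ne p q hp hp'
    simp only [Finset.mem_filter, Finset.mem_range, Finset.mem_insert, Finset.mem_Icc]
    rcases Nat.eq_zero_or_pos q with rfl | hq
    · simp [h0, h1]
    · constructor
      · rintro ⟨h3, h4⟩
        exact Or.inr ⟨⟨hq, by omega⟩, lt_of_le_of_ne h4 (Ne.symm (h2 hq (by omega)))⟩
      · rintro (h3 | ⟨h3, h4⟩)
        · omega
        · exact ⟨by omega, h4.le⟩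
  rw [this, Finset.card_insert_of_notMem (by simp), add_comm]

/-- The summed difference equation: `a p` counts, apart from a linear term, the pairs `(k, l)` with
`b l < a k`. -/
theorem left_eq (h : IsArmPair M N a b) : ∀ p ≤ M,
    a p = p + 1 + ((Finset.Icc 1 p ×ˢ Finset.Icc 1 N).filter (fun x => b x.2 < a x.1)).card
  | 0, _ => by simp [h.left_zero]
  | p + 1, hp => by
    rw [h.left_succ p hp, h.card_filter (by omega) hp, h.left_eq p (by omega)]
    simp only [Finset.card_filter, Finset.sum_product]
    rw [Finset.sum_Icc_succ_top (by omega)]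
    omega

/-- Dropping `a M` when it exceeds all values of `b` leaves a solution. -/
theorem pred_left (h : IsArmPair (M + 1) N a b) (hlt : b N < a (M + 1)) : IsArmPair M N a b := by
  refine ⟨h.left_zero, h.right_zero, fun p hp => h.left_succ p (by omega), fun q hq => ?_,
    fun p q hp hp' => h.ne p q hp (by omega)⟩
  have h1 := h.right_succ q hq
  rwa [Finset.range_add_one (n := M + 1), Finset.filter_insert, if_neg] at h1
  exact not_le.2 ((h.right_le (Nat.succ_le_of_lt hq) le_rfl).trans_lt hlt)

end IsArmPair

/-! ### Linear separation -/

/-- The pairs `(p, q)` in `[1, M] × [1, N]` with `a p < b q` have smaller slopes `p / q` than those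
with `b q < a p`. -/
def IsSeparated (M N : ℕ) (a b : ℕ → ℕ) : Prop :=
  ∀ p q p' q', 1 ≤ p → p ≤ M → 1 ≤ q → q ≤ N → 1 ≤ p' → p' ≤ M → 1 ≤ q' → q' ≤ N →
    a p < b q → b q' < a p' → p * q' < p' * q

theorem IsSeparated.swap {M N : ℕ} {a b : ℕ → ℕ} (h : IsSeparated M N a b) :
    IsSeparated N M b a := by
  intro q p q' p' hq hq' hp hp' h1 h2 h3 h4 h5 h6
  have := h p' q' p q h3 h4 h1 h2 hp hp' hq hq' h6 h5
  linarith [mul_comm p q', mul_comm p' q]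

/-- The reflection argument. A pair `(p, q)` with `a p < b q` and slope at least `(M + 1) / N` would
make the point reflection `(k, l) ↦ (M + 1 - k, N - l)` map the pairs with `b l < a k`, and
`(p, q)` too, to pairs with `a k < b l`. Together with the pairs `(k, N)` the latter would then be
so many that `a (M + 1) ≤ b N`. -/
theorem IsArmPair.slope_lt {M N : ℕ} {a b : ℕ → ℕ} (h : IsArmPair (M + 1) N a b)
    (hlt : b N < a (M + 1)) (hsep : IsSeparated M N a b) {p q : ℕ} (hp : 1 ≤ p) (hp' : p ≤ M)
    (hq : 1 ≤ q) (hq' : q ≤ N) (hpq : a p < b q) : p * N < (M + 1) * q := by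
  by_contra! hc
  set R : Finset (ℕ × ℕ) := Finset.Icc 1 M ×ˢ Finset.Icc 1 N with hR
  set S := R.filter (fun x => b x.2 < a x.1) with hS
  set T := R.filter (fun x => a x.1 < b x.2) with hT
  have memR : ∀ x : ℕ × ℕ, x ∈ R ↔ (1 ≤ x.1 ∧ x.1 ≤ M) ∧ 1 ≤ x.2 ∧ x.2 ≤ N := by
    intro x; simp [hR]
  -- Membership in `T` follows as soon as the slope is at most that of `(p, q)`.
  have memT : ∀ k l, 1 ≤ k → k ≤ M → 1 ≤ l → l ≤ N → k * q ≤ p * l → (k, l) ∈ T := by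
    intro k l hk hk' hl hl' hkl
    refine Finset.mem_filter.2 ⟨(memR _).2 ⟨⟨hk, hk'⟩, hl, hl'⟩, ?_⟩
    by_contra hn
    have h1 : b l < a k := lt_of_le_of_ne (not_lt.1 hn) (h.ne k l hk (by omega) hl hl').symm
    have := hsep p q k l hp hp' hq hq' hk hk' hl hl' hpq h1
    omega
  have hpqS : (p, q) ∉ S := fun hx => by
    have := (Finset.mem_filter.1 hx).2
    simp only at this
    omega
  -- Points of `insert (p, q) S` have slope at least `p / q`.
  have slopeS : ∀ x ∈ insert (p, q) S, (1 ≤ x.1 ∧ x.1 ≤ M) ∧ (1 ≤ x.2 ∧ x.2 ≤ N) ∧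
      p * x.2 ≤ x.1 * q := by
    intro x hx
    rcases Finset.mem_insert.1 hx with rfl | hx
    · exact ⟨⟨hp, hp'⟩, ⟨hq, hq'⟩, le_rfl⟩
    · obtain ⟨hx1, hx2⟩ := Finset.mem_filter.1 hx
      obtain ⟨h1, h2⟩ := (memR x).1 hx1
      exact ⟨h1, h2, (hsep p q x.1 x.2 hp hp' hq hq' h1.1 h1.2 h2.1 h2.2 hpq hx2).le⟩
  have slopeN : ∀ x ∈ insert (p, q) S, x.2 < N := by
    intro x hx
    obtain ⟨⟨h1, h1'⟩, ⟨h2, h2'⟩, h3⟩ := slopeS x hx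
    by_contra hn
    have hxN : x.2 = N := by omega
    rw [hxN] at h3
    have : (M + 1) * q ≤ x.1 * q := hc.trans h3
    have := Nat.le_of_mul_le_mul_right this hq
    omega
  set U := (insert (p, q) S).image (fun x => (M + 1 - x.1, N - x.2)) with hU
  set V := (Finset.Icc 1 M).image (fun k => (k, N)) with hV
  have hUcard : U.card = S.card + 1 := by
    rw [hU, Finset.card_image_of_injOn, Finset.card_insert_of_notMem hpqS]
    intro x hx y hy hxy
    obtain ⟨h1, h2, -⟩ := slopeS x hx
    obtain ⟨h3, h4, -⟩ := slopeS y hy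
    simp only [Prod.mk.injEq] at hxy
    ext <;> omega
  have hVcard : V.card = M := by
    rw [hV, Finset.card_image_of_injective _ (fun x y hxy => (Prod.mk.inj hxy).1)]
    simp
  have hdisj : Disjoint U V := by
    rw [Finset.disjoint_left]
    intro y hy hy'
    obtain ⟨x, hx, rfl⟩ := Finset.mem_image.1 hy
    obtain ⟨k, -, hk⟩ := Finset.mem_image.1 hy'
    obtain ⟨-, h2, -⟩ := slopeS x hx
    have := (Prod.mk.inj hk).2
    omega
  have hsub : U ∪ V ⊆ T := by
    intro y hy
    rcases Finset.mem_union.1 hy with hy | hy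
    · obtain ⟨x, hx, rfl⟩ := Finset.mem_image.1 hy
      obtain ⟨h1, h2, h3⟩ := slopeS x hx
      have h4 := slopeN x hx
      refine memT _ _ (by omega) (by omega) (by omega) (by omega) ?_
      rw [Nat.sub_mul, Nat.mul_sub]
      omega
    · obtain ⟨k, hk, rfl⟩ := Finset.mem_image.1 hy
      obtain ⟨hk1, hk2⟩ := Finset.mem_Icc.1 hk
      refine memT _ _ hk1 hk2 (by omega) le_rfl (le_trans ?_ hc)
      exact Nat.mul_le_mul_right _ (by omega)
  have hTcard : S.card + 1 + M ≤ T.card := by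
    rw [← hUcard, ← hVcard, ← Finset.card_union_of_disjoint hdisj]
    exact Finset.card_le_card hsub
  have ha : a M = M + 1 + S.card := h.left_eq M (by omega) |>.trans (by rw [hS, hR])
  have hb : b N = N + 1 + T.card := by
    rw [(h.pred_left hlt).swap.left_eq N le_rfl]
    congr 1
    refine Finset.card_bij (fun x _ => x.swap) ?_ (fun _ _ _ _ => Prod.swap_injective.eq_iff.1) ?_
    · intro x hx
      simp only [Finset.mem_filter, Finset.mem_product] at hx
      exact Finset.mem_filter.2 ⟨Finset.mem_product.2 ⟨hx.1.2, hx.1.1⟩, hx.2⟩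
    · intro x hx
      obtain ⟨hx1, hx2⟩ := Finset.mem_filter.1 hx
      refine ⟨x.swap, Finset.mem_filter.2 ⟨?_, hx2⟩, x.swap_swap⟩
      have := Finset.mem_product.1 hx1
      exact Finset.mem_product.2 ⟨this.2, this.1⟩
  have hcard : ((Finset.range (N + 1)).filter (b · ≤ a (M + 1))).card ≤ N + 1 :=
    (Finset.card_filter_le _ _).trans (Finset.card_range _).le
  have := h.left_succ M (by omega)
  omega

theorem IsArmPair.isSeparated_succ {M N : ℕ} {a b : ℕ → ℕ} (h : IsArmPair (M + 1) N a b)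
    (hlt : b N < a (M + 1)) (hsep : IsSeparated M N a b) : IsSeparated (M + 1) N a b := by
  intro p q p' q' hp hp1 hq hq1 hp' hp1' hq' hq1' hpq hpq'
  have hpM : p ≤ M := by
    by_contra hn
    obtain rfl : p = M + 1 := by omega
    have := h.right_le hq1 le_rfl
    omega
  rcases hp1'.eq_or_lt with rfl | hlt'
  · exact (Nat.mul_le_mul_left p hq1').trans_lt (h.slope_lt hlt hsep hp hpM hq hq1 hpq)
  · exact hsep p q p' q' hp hpM hq hq1 hp' (by omega) hq' hq1' hpq hpq'

theorem IsArmPair.isSeparated {M N : ℕ} {a b : ℕ → ℕ} (h : IsArmPair M N a b) :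
    IsSeparated M N a b := by
  induction hs : M + N generalizing M N with
  | zero =>
    intro p q p' q' hp hp1
    omega
  | succ s ih =>
    rcases M with _ | M
    · intro p q p' q' hp hp1
      omega
    rcases N with _ | N
    · intro p q p' q' hp hp1 hq hq1
      omega
    -- The larger of the two last values is the largest value altogether.
    rcases lt_or_gt_of_ne (h.ne (M + 1) (N + 1) (by omega) le_rfl (by omega) le_rfl) with hlt | hlt
    · exact (h.swap.isSeparated_succ hlt (ih (h.swap.pred_left hlt).swap (by omega)).swap).swap
    · exact h.isSeparated_succ hlt (ih (h.pred_left hlt) (by omega))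

/-- A separating slope: `a p < b q` if and only if `p < q ξ`. -/
theorem IsArmPair.exists_slope {M N : ℕ} {a b : ℕ → ℕ} (h : IsArmPair M N a b) :
    ∃ ξ : ℝ, 0 < ξ ∧ ∀ p q, 1 ≤ p → p ≤ M → 1 ≤ q → q ≤ N →
      (p : ℝ) ≠ q * ξ ∧ (a p < b q ↔ (p : ℝ) < q * ξ) := by
  classical
  set R : Finset (ℕ × ℕ) := Finset.Icc 1 M ×ˢ Finset.Icc 1 N with hR
  have memR : ∀ x : ℕ × ℕ, x ∈ R ↔ (1 ≤ x.1 ∧ x.1 ≤ M) ∧ 1 ≤ x.2 ∧ x.2 ≤ N := by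
    intro x; simp [hR]
  let r : ℕ × ℕ → ℝ := fun x => (x.1 : ℝ) / x.2
  obtain ⟨ξ, h1, h2⟩ := Order.exists_between_finsets
    (insert 0 ((R.filter (fun x => a x.1 < b x.2)).image r))
    ((R.filter (fun x => b x.2 < a x.1)).image r) (by
      intro x hx z hz
      obtain ⟨y, hy, rfl⟩ := Finset.mem_image.1 hz
      obtain ⟨hy1, hy2⟩ := Finset.mem_filter.1 hy
      obtain ⟨hy3, hy4⟩ := (memR y).1 hy1
      have hy5 : (0 : ℝ) < y.1 := by exact_mod_cast hy3.1
      have hy6 : (0 : ℝ) < y.2 := by exact_mod_cast hy4.1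
      rcases Finset.mem_insert.1 hx with rfl | hx
      · exact div_pos hy5 hy6
      · obtain ⟨w, hw, rfl⟩ := Finset.mem_image.1 hx
        obtain ⟨hx1, hx2⟩ := Finset.mem_filter.1 hw
        obtain ⟨hx3, hx4⟩ := (memR w).1 hx1
        have hx6 : (0 : ℝ) < w.2 := by exact_mod_cast hx4.1
        refine (div_lt_div_iff₀ hx6 hy6).2 ?_
        exact_mod_cast h.isSeparated w.1 w.2 y.1 y.2 hx3.1 hx3.2 hx4.1 hx4.2 hy3.1 hy3.2 hy4.1
          hy4.2 hx2 hy2)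
  refine ⟨ξ, h1 0 (Finset.mem_insert_self _ _), fun p q hp hp' hq hq' => ?_⟩
  have hq0 : (0 : ℝ) < q := by exact_mod_cast hq
  have hm : (p, q) ∈ R := (memR _).2 ⟨⟨hp, hp'⟩, hq, hq'⟩
  rcases lt_or_gt_of_ne (h.ne p q hp hp' hq hq') with hlt | hlt
  · have h3 : (p : ℝ) < q * ξ := (div_lt_iff₀' hq0).1 (h1 (r (p, q)) (Finset.mem_insert_of_mem
      (Finset.mem_image_of_mem r (Finset.mem_filter.2 ⟨hm, hlt⟩))))
    exact ⟨h3.ne, iff_of_true hlt h3⟩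
  · have h3 : q * ξ < p := (lt_div_iff₀' hq0).1 (h2 (r (p, q))
      (Finset.mem_image_of_mem r (Finset.mem_filter.2 ⟨hm, hlt⟩)))
    exact ⟨h3.ne', iff_of_false hlt.not_gt h3.not_gt⟩

/-- The comparisons between the two arms determine the first arm. -/
theorem IsArmPair.left_eq_of_lt_iff {M N : ℕ} {a b a' b' : ℕ → ℕ} (h : IsArmPair M N a b)
    (h' : IsArmPair M N a' b')
    (hiff : ∀ p q, 1 ≤ p → p ≤ M → 1 ≤ q → q ≤ N → (a p < b q ↔ a' p < b' q)) :
    ∀ p ≤ M, a p = a' p := by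
  intro p hp
  rw [h.left_eq p hp, h'.left_eq p hp]
  congr 2
  refine Finset.filter_congr fun x hx => ?_
  simp only [Finset.mem_product, Finset.mem_Icc] at hx
  have h1 := hiff x.1 x.2 hx.1.1 (by omega) hx.2.1 hx.2.2
  have h2 := h.ne x.1 x.2 hx.1.1 (by omega) hx.2.1 hx.2.2
  have h3 := h'.ne x.1 x.2 hx.1.1 (by omega) hx.2.1 hx.2.2
  omega

/-! ### L-shapes as pairs of sequences -/

/-- The values `f (p + 1, 1)` for `p < m`, and `0` beyond. -/
def hArm {m n : ℕ} (f : lShape m n → seg (m * n)) (p : ℕ) : ℕ :=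
  if hp : p + 1 ≤ m then (f (hPoint n ⟨p + 1, by simp, hp⟩) : ℕ) else 0

/-- The values `f (1, q + 1)` for `q < n`, and `0` beyond. -/
def vArm {m n : ℕ} (f : lShape m n → seg (m * n)) (q : ℕ) : ℕ :=
  if hq : q + 1 ≤ n then (f (vPoint m ⟨q + 1, by simp, hq⟩) : ℕ) else 0

theorem hArm_apply {m n : ℕ} (f : lShape m n → seg (m * n)) {p : ℕ} (hp : p + 1 ≤ m) :
    hArm f p = f (hPoint n ⟨p + 1, by simp, hp⟩) := dif_pos hp

theorem vArm_apply {m n : ℕ} (f : lShape m n → seg (m * n)) {q : ℕ} (hq : q + 1 ≤ n) :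
    vArm f q = f (vPoint m ⟨q + 1, by simp, hq⟩) := dif_pos hq

/-- Sums over the subtype `[k]`, reindexed to start at `0`. -/
theorem sum_seg {A : Type*} [AddCommMonoid A] (k : ℕ) (g : seg k → A) (g' : ℕ → A)
    (h : ∀ i (hi : i + 1 ≤ k), g ⟨i + 1, by simp, hi⟩ = g' i) :
    ∑ t : seg k, g t = ∑ i ∈ Finset.range k, g' i := by
  refine Finset.sum_bij (fun t _ => t.1 - 1) ?_ ?_ ?_ ?_
  · rintro ⟨t, h1, h2⟩ -
    simp only [Finset.mem_range]
    omega
  · rintro ⟨t, h1, h2⟩ - ⟨t', h1', h2'⟩ - htt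
    simp only at htt
    ext
    simp only
    omega
  · intro i hi
    have := Finset.mem_range.1 hi
    exact ⟨⟨i + 1, by simp, this⟩, Finset.mem_univ _, by simp⟩
  · rintro ⟨t, h1, h2⟩ -
    obtain ⟨i, rfl⟩ := Nat.exists_eq_add_of_le' h1
    simpa using h i h2

theorem isArmPair_of_mem {M N : ℕ} {f : lShape (M + 1) (N + 1) → seg ((M + 1) * (N + 1))}
    (hf : f ∈ injLShapes (M + 1) (N + 1)) : IsArmPair M N (hArm f) (vArm f) := by
  obtain ⟨hinj, ⟨hE1, hE2⟩, hmem, hone⟩ := hf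
  refine ⟨?_, ?_, fun p hp => ?_, fun q hq => ?_, fun p q hp hp' hq hq' => ?_⟩
  · exact (hArm_apply f (by omega)).trans hone
  · exact (vArm_apply f (by omega)).trans hone
  · have h1 := hE1 ⟨p + 1, by simp, by omega⟩ ⟨p + 1 + 1, by simp, by omega⟩ rfl
    rw [← hArm_apply f (p := p + 1) (by omega), ← hArm_apply f (p := p) (by omega), sum_seg (N + 1) _
      (fun q => if vArm f q ≤ hArm f (p + 1) then 1 else 0)
      (fun q hq => by rw [vArm_apply f hq]), ← Finset.natCast_card_filter] at h1
    omega
  · have h1 := hE2 ⟨q + 1, by simp, by omega⟩ ⟨q + 1 + 1, by simp, by omega⟩ rfl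
    rw [← vArm_apply f (q := q + 1) (by omega), ← vArm_apply f (q := q) (by omega), sum_seg (M + 1) _
      (fun p => if hArm f p ≤ vArm f (q + 1) then 1 else 0)
      (fun p hp => by rw [hArm_apply f hp]), ← Finset.natCast_card_filter] at h1
    omega
  · rw [hArm_apply f (by omega), vArm_apply f (by omega)]
    intro heq
    have h1 := hinj (Subtype.ext heq)
    have h2 : p + 1 = 1 := congrArg (fun x => x.1.1) h1
    omega

theorem eq_of_arms_eq {M N : ℕ} {f g : lShape (M + 1) (N + 1) → seg ((M + 1) * (N + 1))}
    (h1 : ∀ p ≤ M, hArm f p = hArm g p) (h2 : ∀ q ≤ N, vArm f q = vArm g q) : f = g := by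
  funext x
  apply Subtype.ext
  obtain ⟨⟨i, j⟩, hx⟩ := x
  have hx' := hx
  simp only [lShape, seg, Set.mem_union, Set.mem_prod, Set.mem_Icc, Set.mem_singleton_iff] at hx'
  rcases hx' with ⟨⟨hi, hi'⟩, rfl⟩ | ⟨rfl, hj, hj'⟩
  · obtain ⟨p, rfl⟩ := Nat.exists_eq_add_of_le' hi
    have := h1 p (by omega)
    rwa [hArm_apply f hi', hArm_apply g hi'] at this
  · obtain ⟨q, rfl⟩ := Nat.exists_eq_add_of_le' hj
    have := h2 q (by omega)
    rwa [vArm_apply f hj', vArm_apply g hj'] at this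

/-- An injective L-shape of difference equation type is determined by the comparisons between its
two arms. -/
theorem eq_of_lt_iff {M N : ℕ} {f g : lShape (M + 1) (N + 1) → seg ((M + 1) * (N + 1))}
    (hf : f ∈ injLShapes (M + 1) (N + 1)) (hg : g ∈ injLShapes (M + 1) (N + 1))
    (hiff : ∀ p q, 1 ≤ p → p ≤ M → 1 ≤ q → q ≤ N →
      (hArm f p < vArm f q ↔ hArm g p < vArm g q)) : f = g := by
  have h := isArmPair_of_mem hf
  have h' := isArmPair_of_mem hg
  refine eq_of_arms_eq (h.left_eq_of_lt_iff h' hiff)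
    (h.swap.left_eq_of_lt_iff h'.swap fun q p hq hq' hp hp' => ?_)
  have h1 := hiff p q hp hp' hq hq'
  have h2 := h.ne p q hp hp' hq hq'
  have h3 := h'.ne p q hp hp' hq hq'
  omega

/-! ### Ranking tables satisfy the difference equations -/

theorem rankValue_eq_card (m n : ℕ) (ξ : ℝ) (i j : ℕ) :
    rankValue m n ξ i j = ((Finset.Icc 1 m ×ˢ Finset.Icc 1 n).filter
      (fun x : ℕ × ℕ => (x.1 : ℝ) + x.2 * ξ ≤ i + j * ξ)).card := by
  rw [rankValue, Finset.card_filter, Finset.sum_product]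

theorem rankValue_le_iff {m n : ℕ} (ξ : ℝ) {i j : ℕ} (i' j' : ℕ) (h : (i, j) ∈ rect m n) :
    rankValue m n ξ i j ≤ rankValue m n ξ i' j' ↔ (i : ℝ) + j * ξ ≤ i' + j' * ξ := by
  rw [rankValue_eq_card, rankValue_eq_card]
  constructor
  · intro hle
    by_contra! hlt
    refine absurd hle (not_le.2 (Finset.card_lt_card (Finset.ssubset_iff_of_subset ?_ |>.2
      ⟨(i, j), ?_, ?_⟩)))
    · exact Finset.monotone_filter_right _ fun x _ hx => hx.trans hlt.le
    · exact Finset.mem_filter.2 ⟨Finset.mem_product.2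
        ⟨Finset.mem_Icc.2 h.1, Finset.mem_Icc.2 h.2⟩, le_rfl⟩
    · exact fun hx => absurd (Finset.mem_filter.1 hx).2 (not_le.2 hlt)
  · intro hle
    exact Finset.card_le_card (Finset.monotone_filter_right _ fun x _ hx => hx.trans hle)

theorem sum_Icc_add_shift (g : ℕ → ℕ) (k : ℕ) :
    ∑ s ∈ Finset.Icc 1 k, g s + g (k + 1) = g 1 + ∑ s ∈ Finset.Icc 1 k, g (s + 1) := by
  induction k with
  | zero => simp
  | succ k ih =>
    rw [Finset.sum_Icc_succ_top (by omega), Finset.sum_Icc_succ_top (by omega), ih]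
    omega

/-- In each row `t`, raising the bound by `1` adds exactly one lattice point, unless the row has no
point below the bound at all. -/
theorem rankValue_succ_left {m n : ℕ} {ξ : ℝ} (hξ : 0 < ξ) {i : ℕ} (hi : i + 1 ≤ m) :
    rankValue m n ξ (i + 1) 1 = rankValue m n ξ i 1 + ∑ t ∈ Finset.Icc 1 n,
      if ((1 : ℕ) : ℝ) + t * ξ ≤ ((i + 1 : ℕ) : ℝ) + (1 : ℕ) * ξ then 1 else 0 := by
  rw [rankValue, rankValue, Finset.sum_comm, Finset.sum_comm (s := Finset.Icc 1 m),
    ← Finset.sum_add_distrib]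
  refine Finset.sum_congr rfl fun t ht => ?_
  have h := sum_Icc_add_shift
    (fun s => if (s : ℝ) + t * ξ ≤ ((i + 1 : ℕ) : ℝ) + (1 : ℕ) * ξ then 1 else 0) m
  rw [if_neg, add_zero] at h
  · rw [h, add_comm]
    congr 1
    refine Finset.sum_congr rfl fun s _ => if_congr ?_ rfl rfl
    push_cast
    constructor <;> intro h' <;> linarith
  · have h1 : (1 : ℝ) ≤ t := by exact_mod_cast (Finset.mem_Icc.1 ht).1
    have h2 : ((i + 1 : ℕ) : ℝ) ≤ m := by exact_mod_cast hi
    push_cast at h2 ⊢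
    nlinarith

/-- The column-wise analogue of `rankValue_succ_left`. -/
theorem rankValue_succ_right {m n : ℕ} {ξ : ℝ} (hξ : 0 < ξ) {j : ℕ} (hj : j + 1 ≤ n) :
    rankValue m n ξ 1 (j + 1) = rankValue m n ξ 1 j + ∑ s ∈ Finset.Icc 1 m,
      if (s : ℝ) + (1 : ℕ) * ξ ≤ ((1 : ℕ) : ℝ) + (j + 1 : ℕ) * ξ then 1 else 0 := by
  rw [rankValue, rankValue, ← Finset.sum_add_distrib]
  refine Finset.sum_congr rfl fun s hs => ?_
  have h := sum_Icc_add_shift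
    (fun t => if (s : ℝ) + t * ξ ≤ ((1 : ℕ) : ℝ) + (j + 1 : ℕ) * ξ then 1 else 0) n
  rw [if_neg, add_zero] at h
  · rw [h, add_comm]
    congr 1
    refine Finset.sum_congr rfl fun t _ => if_congr ?_ rfl rfl
    push_cast
    constructor <;> intro h' <;> linarith
  · have h1 : (1 : ℝ) ≤ s := by exact_mod_cast (Finset.mem_Icc.1 hs).1
    have h2 : ((j + 1 : ℕ) : ℝ) ≤ n := by exact_mod_cast hj
    push_cast at h2 ⊢
    nlinarith

theorem rankValue_one_one {m n : ℕ} {ξ : ℝ} (hξ : 0 < ξ) (hm : 0 < m) (hn : 0 < n) :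
    rankValue m n ξ 1 1 = 1 := by
  rw [rankValue_eq_card, Finset.card_eq_one]
  refine ⟨(1, 1), ?_⟩
  ext ⟨s, t⟩
  simp only [Finset.mem_filter, Finset.mem_product, Finset.mem_Icc, Finset.mem_singleton,
    Prod.mk.injEq]
  constructor
  · rintro ⟨⟨⟨hs, -⟩, ht, -⟩, hle⟩
    have h1 : (1 : ℝ) ≤ s := by exact_mod_cast hs
    have h2 : (1 : ℝ) ≤ t := by exact_mod_cast ht
    push_cast at hle
    have h3 : (s : ℝ) ≤ 1 := by nlinarith
    have h4 : (t : ℝ) ≤ 1 := by nlinarith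
    have h3' : s ≤ 1 := by exact_mod_cast h3
    have h4' : t ≤ 1 := by exact_mod_cast h4
    omega
  · rintro ⟨rfl, rfl⟩
    exact ⟨⟨⟨le_rfl, hm⟩, le_rfl, hn⟩, le_rfl⟩

/-- The restriction of `τ_ξ` to the L-shaped domain. -/
noncomputable def rankLShape {m n : ℕ} (hm : 0 < m) (hn : 0 < n) (ξ : ℝ) :
    lShape m n → seg (m * n) :=
  fun p => rankTable m n ξ (Set.inclusion (lShape_subset_rect hm hn) p)

/-- The slopes `ξ > 0` different from all fractions `p / q` with `p ≤ M` and `q ≤ N`. For tables of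
size `(M + 1, N + 1)` these are the ones with `τ_ξ` injective, see `rankTable_injective_iff`. -/
def IsGenericSlope (M N : ℕ) (ξ : ℝ) : Prop :=
  0 < ξ ∧ ∀ p q, 1 ≤ p → p ≤ M → 1 ≤ q → q ≤ N → (p : ℝ) ≠ q * ξ

theorem rankTable_injective_iff {M N : ℕ} {ξ : ℝ} (hξ : 0 < ξ) :
    Function.Injective (rankTable (M + 1) (N + 1) ξ) ↔ IsGenericSlope M N ξ := by
  constructor
  · refine fun hinj => ⟨hξ, fun p q hp hp' hq hq' heq => ?_⟩
    have h1 : (p + 1, 1) ∈ rect (M + 1) (N + 1) := ⟨⟨by simp, by simpa using hp'⟩, by simp, by simp⟩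
    have h2 : (1, q + 1) ∈ rect (M + 1) (N + 1) := ⟨⟨by simp, by simp⟩, by simp, by simpa using hq'⟩
    have h3 : rankTable (M + 1) (N + 1) ξ ⟨_, h1⟩ = rankTable (M + 1) (N + 1) ξ ⟨_, h2⟩ := by
      refine Subtype.ext (le_antisymm ?_ ?_)
      · refine (rankValue_le_iff ξ _ _ h1).2 ?_
        push_cast
        linarith
      · refine (rankValue_le_iff ξ _ _ h2).2 ?_
        push_cast
        linarith
    have h4 : p + 1 = 1 := congrArg (fun x => x.1.1) (hinj h3)
    omega
  · -- Points of equal rank satisfy `s - i = (j - t) ξ`, so one of `s - i` and `j - t` vanishes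
    -- or both have the same sign.
    have key : IsGenericSlope M N ξ → ∀ i j s t : ℕ, (i, j) ∈ rect (M + 1) (N + 1) →
        (s, t) ∈ rect (M + 1) (N + 1) → i ≤ s → (i : ℝ) + j * ξ = s + t * ξ → i = s ∧ j = t := by
      rintro hgen i j s t ⟨⟨hi, hi'⟩, hj, hj'⟩ ⟨⟨hs, hs'⟩, ht, ht'⟩ his heq
      simp only at hi hi' hj hj' hs hs' ht ht'
      have h1 : (i : ℝ) ≤ s := by exact_mod_cast his
      have h2 : t ≤ j := by
        by_contra! hlt
        have : (j : ℝ) < t := by exact_mod_cast hlt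
        nlinarith
      by_cases hps : i = s
      · subst hps
        refine ⟨rfl, ?_⟩
        have h3 : (j : ℝ) * ξ = t * ξ := by linarith
        exact_mod_cast mul_right_cancel₀ hξ.ne' h3
      · have h3 : t ≠ j := by
          rintro rfl
          exact hps (by exact_mod_cast (add_right_cancel heq : (i : ℝ) = s))
        refine absurd ?_ (hgen.2 (s - i) (j - t) (by omega) (by omega) (by omega) (by omega))
        rw [Nat.cast_sub his, Nat.cast_sub h2]
        linarith
    rintro hgen ⟨⟨i, j⟩, hx⟩ ⟨⟨s, t⟩, hy⟩ hxy
    have hv : rankValue (M + 1) (N + 1) ξ i j = rankValue (M + 1) (N + 1) ξ s t :=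
      congrArg Subtype.val hxy
    have heq : (i : ℝ) + j * ξ = s + t * ξ :=
      le_antisymm ((rankValue_le_iff ξ _ _ hx).1 hv.le) ((rankValue_le_iff ξ _ _ hy).1 hv.ge)
    apply Subtype.ext
    rcases le_total i s with his | his
    · obtain ⟨h1, h2⟩ := key hgen i j s t hx hy his heq
      exact Prod.ext h1 h2
    · obtain ⟨h1, h2⟩ := key hgen s t i j hy hx his heq.symm
      exact Prod.ext h1.symm h2.symm

theorem mem_youngLShapes_iff {M N : ℕ} (hm : 0 < M + 1) (hn : 0 < N + 1)
    {f : lShape (M + 1) (N + 1) → seg ((M + 1) * (N + 1))} :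
    f ∈ youngLShapes (M + 1) (N + 1) hm hn ↔
      ∃ ξ, IsGenericSlope M N ξ ∧ f = rankLShape hm hn ξ := by
  constructor
  · rintro ⟨_, ⟨hinj, ξ, hξ, rfl⟩, rfl⟩
    exact ⟨ξ, (rankTable_injective_iff hξ).1 hinj, rfl⟩
  · rintro ⟨ξ, hgen, rfl⟩
    exact ⟨_, ⟨(rankTable_injective_iff hgen.1).2 hgen, ξ, hgen.1, rfl⟩, rfl⟩

theorem sum_seg_eq_sum_Icc {A : Type*} [AddCommMonoid A] (k : ℕ) (g : ℕ → A) :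
    ∑ t : seg k, g t = ∑ t ∈ Finset.Icc 1 k, g t := by
  rw [sum_seg k (fun t => g t) (fun i => g (i + 1)) (fun _ _ => rfl), Finset.range_eq_Ico,
    Finset.sum_Ico_add' g 0 k 1]
  rfl

theorem rankLShape_mem_injLShapes {M N : ℕ} (hm : 0 < M + 1) (hn : 0 < N + 1) {ξ : ℝ}
    (hgen : IsGenericSlope M N ξ) :
    rankLShape hm hn ξ ∈ injLShapes (M + 1) (N + 1) := by
  have hinj := (rankTable_injective_iff hgen.1).2 hgen
  have hh : ∀ i : seg (M + 1), ((rankLShape hm hn ξ (hPoint (N + 1) i) : ℕ)) =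
      rankValue (M + 1) (N + 1) ξ i 1 := fun _ => rfl
  have hv : ∀ j : seg (N + 1), ((rankLShape hm hn ξ (vPoint (M + 1) j) : ℕ)) =
      rankValue (M + 1) (N + 1) ξ 1 j := fun _ => rfl
  have hhm : ∀ i : seg (M + 1), (i.1, 1) ∈ rect (M + 1) (N + 1) :=
    fun i => ⟨i.2, by simp, by simp⟩
  have hvm : ∀ j : seg (N + 1), (1, j.1) ∈ rect (M + 1) (N + 1) :=
    fun j => ⟨⟨by simp, by simp⟩, j.2⟩
  refine ⟨hinj.comp (Set.inclusion_injective _), ⟨?_, ?_⟩,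
    Or.inl ⟨⟨le_rfl, by simp⟩, rfl⟩, rankValue_one_one hgen.1 hm hn⟩
  · rintro ⟨i, hi⟩ ⟨i', hi'⟩ h
    simp only at h
    subst h
    simp only [hh, hv]
    rw [Finset.sum_congr rfl fun t _ => if_congr (rankValue_le_iff ξ _ _ (hvm t)) rfl rfl,
      rankValue_succ_left hgen.1 hi'.2, Nat.cast_add, add_sub_cancel_left, ← sum_seg_eq_sum_Icc,
      Nat.cast_sum]
    refine Finset.sum_congr rfl fun t _ => ?_
    split_ifs <;> rfl
  · rintro ⟨j, hj⟩ ⟨j', hj'⟩ h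
    simp only at h
    subst h
    simp only [hh, hv]
    rw [Finset.sum_congr rfl fun s _ => if_congr (rankValue_le_iff ξ _ _ (hhm s)) rfl rfl,
      rankValue_succ_right hgen.1 hj'.2, Nat.cast_add, add_sub_cancel_left, ← sum_seg_eq_sum_Icc,
      Nat.cast_sum]
    refine Finset.sum_congr rfl fun s _ => ?_
    split_ifs <;> rfl

theorem rankLShape_arms_lt_iff {M N : ℕ} (hm : 0 < M + 1) (hn : 0 < N + 1) (ξ : ℝ) {p q : ℕ}
    (hp : p ≤ M) (hq : q ≤ N) :
    hArm (rankLShape hm hn ξ) p < vArm (rankLShape hm hn ξ) q ↔ (p : ℝ) < q * ξ := by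
  rw [hArm_apply _ (Nat.succ_le_succ hp), vArm_apply _ (Nat.succ_le_succ hq), ← not_le, ← not_le,
    not_iff_not]
  have hmem : (1, q + 1) ∈ rect (M + 1) (N + 1) := ⟨⟨by simp, by simp⟩, by simp, by simpa using hq⟩
  refine (rankValue_le_iff ξ (p + 1) 1 hmem).trans ?_
  push_cast
  constructor <;> intro h <;> linarith

theorem youngLShapes_eq_injLShapes {M N : ℕ} (hm : 0 < M + 1) (hn : 0 < N + 1) :
    youngLShapes (M + 1) (N + 1) hm hn = injLShapes (M + 1) (N + 1) := by
  ext f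
  rw [mem_youngLShapes_iff]
  constructor
  · rintro ⟨ξ, hgen, rfl⟩
    exact rankLShape_mem_injLShapes hm hn hgen
  · intro hf
    obtain ⟨ξ, hξ, h⟩ := (isArmPair_of_mem hf).exists_slope
    have hgen : IsGenericSlope M N ξ := ⟨hξ, fun p q hp hp' hq hq' => (h p q hp hp' hq hq').1⟩
    refine ⟨ξ, hgen, eq_of_lt_iff hf (rankLShape_mem_injLShapes hm hn hgen) ?_⟩
    intro p q hp hp' hq hq'
    rw [(h p q hp hp' hq hq').2, rankLShape_arms_lt_iff hm hn ξ hp' hq']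

/-! ### Counting -/

/-- If `M = 0` or `N = 0` there are no fractions `p / q`, so no case distinction is needed. -/
theorem mem_fareySet_iff {M N : ℕ} {x : EReal} : x ∈ fareySet M N ↔ x = 0 ∨ x = ⊤ ∨
    ∃ p q : ℕ, (1 ≤ p ∧ p ≤ M) ∧ (1 ≤ q ∧ q ≤ N) ∧ x = (((p : ℝ) / (q : ℝ) : ℝ) : EReal) := by
  unfold fareySet
  split_ifs with h
  · have : ¬ ∃ p q : ℕ, (1 ≤ p ∧ p ≤ M) ∧ (1 ≤ q ∧ q ≤ N) ∧
        x = (((p : ℝ) / (q : ℝ) : ℝ) : EReal) := by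
      rintro ⟨p, q, hp, hq, -⟩
      rcases Nat.mul_eq_zero.1 h with h | h <;> omega
    rw [← or_assoc, or_iff_left this, Set.mem_insert_iff, Set.mem_singleton_iff]
  · simp only [seg, Set.mem_union, Set.mem_insert_iff, Set.mem_singleton_iff, Set.mem_Icc,
      Set.mem_ofPred_eq, or_assoc]
    refine or_congr_right (or_congr_right ⟨?_, ?_⟩)
    · rintro ⟨p, hp, q, hq, rfl⟩
      exact ⟨p, q, hp, hq, rfl⟩
    · rintro ⟨p, q, hp, hq, rfl⟩
      exact ⟨p, hp, q, hq, rfl⟩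

theorem fareySet_finite (M N : ℕ) : (fareySet M N).Finite := by
  refine ((Set.toFinite {0, ⊤}).union (((Set.finite_Icc 1 M).prod (Set.finite_Icc 1 N)).image
    fun x : ℕ × ℕ => (((x.1 : ℝ) / (x.2 : ℝ) : ℝ) : EReal))).subset ?_
  intro x hx
  rcases mem_fareySet_iff.1 hx with rfl | rfl | ⟨p, q, hp, hq, rfl⟩
  · simp
  · simp
  · exact Or.inr ⟨(p, q), ⟨hp, hq⟩, rfl⟩

theorem zero_mem_fareySet (M N : ℕ) : 0 ∈ fareySet M N := mem_fareySet_iff.2 (Or.inl rfl)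

theorem top_mem_fareySet (M N : ℕ) : ⊤ ∈ fareySet M N := mem_fareySet_iff.2 (Or.inr (Or.inl rfl))

theorem fareySet_nonneg {M N : ℕ} {x : EReal} (hx : x ∈ fareySet M N) : 0 ≤ x := by
  rcases mem_fareySet_iff.1 hx with rfl | rfl | ⟨p, q, hp, hq, rfl⟩
  · exact le_rfl
  · exact le_top
  · exact_mod_cast (by positivity : (0 : ℝ) ≤ (p : ℝ) / q)

theorem isGenericSlope_iff {M N : ℕ} {ξ : ℝ} :
    IsGenericSlope M N ξ ↔ 0 < ξ ∧ (ξ : EReal) ∉ fareySet M N := by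
  refine and_congr_right fun hξ => ?_
  rw [mem_fareySet_iff]
  constructor
  · rintro h (h1 | h1 | ⟨p, q, hp, hq, h1⟩)
    · exact hξ.ne' (by exact_mod_cast h1)
    · exact EReal.coe_ne_top _ h1
    · have hq0 : (q : ℝ) ≠ 0 := by exact_mod_cast (by omega : q ≠ 0)
      refine h p q hp.1 hp.2 hq.1 hq.2 ?_
      rw [EReal.coe_eq_coe_iff.1 h1, mul_div_cancel₀ _ hq0]
  · intro h p q hp hp' hq hq' h1
    have hq0 : (q : ℝ) ≠ 0 := by exact_mod_cast (by omega : q ≠ 0)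
    refine h (Or.inr (Or.inr ⟨p, q, ⟨hp, hp'⟩, ⟨hq, hq'⟩, ?_⟩))
    rw [h1, mul_div_cancel_left₀ _ hq0]

/-- The real points of the interval between `a` and the next larger element of `G`. -/
def gapAfter (G : Set EReal) (a : EReal) : Set ℝ := {x | a < x ∧ ∀ c ∈ G, a < c → (x : EReal) < c}

/-- Every element of a finite set other than `⊤` has an immediate successor. -/
theorem exists_adjacent {G : Set EReal} (hG : G.Finite) (htop : ⊤ ∈ G) {a : EReal} (ha : a ≠ ⊤) :
    ∃ b ∈ G, a < b ∧ ∀ c ∈ G, a < c → b ≤ c := by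
  obtain ⟨b, hb, hmin⟩ := Set.exists_min_image {c ∈ G | a < c} id (hG.subset (Set.sep_subset _ _))
    ⟨⊤, htop, lt_top_iff_ne_top.2 ha⟩
  exact ⟨b, hb.1, hb.2, fun c hc hac => hmin c ⟨hc, hac⟩⟩

theorem gapAfter_eq {G : Set EReal} {a b : EReal} (hb : b ∈ G) (hab : a < b)
    (h : ∀ c ∈ G, a < c → b ≤ c) : gapAfter G a = {x : ℝ | a < (x : EReal) ∧ (x : EReal) < b} := by
  ext x
  exact and_congr_right fun _ => ⟨fun hx => hx b hb hab, fun hx c hc hac => hx.trans_le (h c hc hac)⟩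

theorem gapAfter_nonempty {G : Set EReal} (hG : G.Finite) (htop : ⊤ ∈ G) {a : EReal} (ha : a ≠ ⊤) :
    (gapAfter G a).Nonempty := by
  obtain ⟨b, hb, hab, h⟩ := exists_adjacent hG htop ha
  rw [gapAfter_eq hb hab h]
  obtain ⟨x, hx, hx'⟩ := EReal.lt_iff_exists_real_btwn.1 hab
  exact ⟨x, hx, hx'⟩

theorem injOn_gapAfter {G : Set EReal} (hG : G.Finite) (htop : ⊤ ∈ G) :
    Set.InjOn (gapAfter G) (G \ {⊤}) := by
  -- The gap after the smaller of two elements ends before the larger one.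
  have key : ∀ a ∈ G \ {⊤}, ∀ b ∈ G \ {⊤}, a < b → gapAfter G a ≠ gapAfter G b := by
    intro a ha b hb hab heq
    obtain ⟨x, hx⟩ := gapAfter_nonempty hG htop (a := a) ha.2
    have h1 := hx.2 b hb.1 hab
    rw [heq] at hx
    exact lt_asymm h1 hx.1
  intro a ha b hb heq
  by_contra hne
  rcases lt_or_gt_of_ne hne with h | h
  · exact key a ha b hb h heq
  · exact key b hb a ha h heq.symm

theorem fareyIntervals_eq_image (M N : ℕ) :
    fareyIntervals M N = gapAfter (fareySet M N) '' (fareySet M N \ {⊤}) := by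
  ext I
  constructor
  · rintro ⟨a, ha, b, hb, hab, hadj, rfl⟩
    exact ⟨a, ⟨ha, (hab.trans_le le_top).ne⟩, gapAfter_eq hb hab
      fun c hc hac => not_lt.1 fun hcb => hadj c hc ⟨hac, hcb⟩⟩
  · rintro ⟨a, ⟨ha, hatop⟩, rfl⟩
    obtain ⟨b, hb, hab, h⟩ := exists_adjacent (fareySet_finite M N) (top_mem_fareySet M N) hatop
    exact ⟨a, ha, b, hb, hab, fun c hc hac => not_lt.2 (h c hc hac.1) hac.2, gapAfter_eq hb hab h⟩

theorem isGenericSlope_of_mem_gapAfter {M N : ℕ} {a : EReal} (ha : a ∈ fareySet M N) {ξ : ℝ}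
    (hξ : ξ ∈ gapAfter (fareySet M N) a) : IsGenericSlope M N ξ := by
  refine isGenericSlope_iff.2 ⟨?_, fun h => lt_irrefl _ (hξ.2 _ h hξ.1)⟩
  exact_mod_cast (fareySet_nonneg ha).trans_lt hξ.1

theorem IsGenericSlope.exists_mem_gapAfter {M N : ℕ} {ξ : ℝ} (h : IsGenericSlope M N ξ) :
    ∃ a ∈ fareySet M N \ {⊤}, ξ ∈ gapAfter (fareySet M N) a := by
  obtain ⟨hξ, hnot⟩ := isGenericSlope_iff.1 h
  obtain ⟨a, ha, hmax⟩ := Set.exists_max_image {c ∈ fareySet M N | c < (ξ : EReal)} id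
    ((fareySet_finite M N).subset (Set.sep_subset _ _))
    ⟨0, zero_mem_fareySet M N, by exact_mod_cast hξ⟩
  refine ⟨a, ⟨ha.1, (ha.2.trans_le le_top).ne⟩, ha.2, fun c hc hac => ?_⟩
  refine lt_of_le_of_ne (not_lt.1 fun hcx => ?_) fun heq => hnot (heq ▸ hc)
  exact absurd (hmax c ⟨hc, hcx⟩) (not_le.2 hac)

/-- The comparisons between the arms of `τ_ξ` depend only on the gap that contains `ξ`. -/
theorem lt_mul_iff_of_mem_gapAfter {M N : ℕ} {a : EReal} {ξ : ℝ}
    (hξ : ξ ∈ gapAfter (fareySet M N) a) {p q : ℕ} (hp : 1 ≤ p) (hp' : p ≤ M) (hq : 1 ≤ q)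
    (hq' : q ≤ N) : (p : ℝ) < q * ξ ↔ (((p : ℝ) / q : ℝ) : EReal) ≤ a := by
  have hq0 : (0 : ℝ) < q := by exact_mod_cast hq
  rw [← div_lt_iff₀' hq0, ← EReal.coe_lt_coe_iff]
  refine ⟨fun h => not_lt.1 fun hlt => ?_, fun h => h.trans_lt hξ.1⟩
  exact lt_asymm h (hξ.2 _ (mem_fareySet_iff.2 (Or.inr (Or.inr ⟨p, q, ⟨hp, hp'⟩, ⟨hq, hq'⟩, rfl⟩)))
    hlt)

theorem encard_youngLShapes {M N : ℕ} (hm : 0 < M + 1) (hn : 0 < N + 1) :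
    (youngLShapes (M + 1) (N + 1) hm hn).encard = (fareySet M N \ {⊤}).encard := by
  have hne : ∀ a : EReal, ∃ ξ : ℝ, a ∈ fareySet M N \ {⊤} → ξ ∈ gapAfter (fareySet M N) a := by
    intro a
    by_cases ha : a ∈ fareySet M N \ {⊤}
    · obtain ⟨ξ, hξ⟩ := gapAfter_nonempty (fareySet_finite M N) (top_mem_fareySet M N) ha.2
      exact ⟨ξ, fun _ => hξ⟩
    · exact ⟨0, fun h => absurd h ha⟩
  choose ξ hξ using hne
  have himage : youngLShapes (M + 1) (N + 1) hm hn =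
      (fun a => rankLShape hm hn (ξ a)) '' (fareySet M N \ {⊤}) := by
    ext f
    rw [mem_youngLShapes_iff]
    constructor
    · rintro ⟨x, hx, rfl⟩
      obtain ⟨a, ha, hxa⟩ := hx.exists_mem_gapAfter
      refine ⟨a, ha, eq_of_lt_iff (rankLShape_mem_injLShapes hm hn
        (isGenericSlope_of_mem_gapAfter ha.1 (hξ a ha))) (rankLShape_mem_injLShapes hm hn hx) ?_⟩
      intro p q hp hp' hq hq'
      rw [rankLShape_arms_lt_iff hm hn _ hp' hq', rankLShape_arms_lt_iff hm hn _ hp' hq',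
        lt_mul_iff_of_mem_gapAfter (hξ a ha) hp hp' hq hq',
        lt_mul_iff_of_mem_gapAfter hxa hp hp' hq hq']
    · rintro ⟨a, ha, rfl⟩
      exact ⟨ξ a, isGenericSlope_of_mem_gapAfter ha.1 (hξ a ha), rfl⟩
  -- For `a < b` the element `b` is a fraction `p / q`, on which the comparisons of the arms at
  -- `p` and `q` disagree.
  have key : ∀ a ∈ fareySet M N \ {⊤}, ∀ b ∈ fareySet M N \ {⊤}, a < b →
      rankLShape hm hn (ξ a) ≠ rankLShape hm hn (ξ b) := by
    intro a ha b hb hab heq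
    rcases mem_fareySet_iff.1 hb.1 with rfl | rfl | ⟨p, q, hp, hq, rfl⟩
    · exact absurd (fareySet_nonneg ha.1) (not_le.2 hab)
    · exact hb.2 rfl
    · have h1 := (rankLShape_arms_lt_iff hm hn (ξ a) hp.2 hq.2).trans
        (lt_mul_iff_of_mem_gapAfter (hξ a ha) hp.1 hp.2 hq.1 hq.2)
      have h2 := (rankLShape_arms_lt_iff hm hn _ hp.2 hq.2).trans
        (lt_mul_iff_of_mem_gapAfter (hξ _ hb) hp.1 hp.2 hq.1 hq.2)
      rw [heq, h2] at h1
      exact absurd (h1.1 le_rfl) (not_le.2 hab)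
  rw [himage]
  refine Set.InjOn.encard_image fun a ha b hb heq => ?_
  by_contra hne
  rcases lt_or_gt_of_ne hne with h | h
  · exact key a ha b hb h heq
  · exact key b hb a ha h heq.symm

theorem corollary2 (m n : ℕ) (hm : 0 < m) (hn : 0 < n) :
    youngLShapes m n hm hn = injLShapes m n ∧
    (fareySet (m - 1) (n - 1)).Finite ∧
    (youngLShapes m n hm hn).encard = (fareyIntervals (m - 1) (n - 1)).encard ∧
    (fareyIntervals (m - 1) (n - 1)).encard + 1 = (fareySet (m - 1) (n - 1)).encard := by
  obtain ⟨M, rfl⟩ := Nat.exists_eq_add_of_le' hm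
  obtain ⟨N, rfl⟩ := Nat.exists_eq_add_of_le' hn
  rw [Nat.add_sub_cancel, Nat.add_sub_cancel]
  have hI : (fareyIntervals M N).encard = (fareySet M N \ {⊤}).encard := by
    rw [fareyIntervals_eq_image,
      (injOn_gapAfter (fareySet_finite M N) (top_mem_fareySet M N)).encard_image]
  refine ⟨youngLShapes_eq_injLShapes hm hn, fareySet_finite M N, ?_, ?_⟩
  · rw [encard_youngLShapes hm hn, hI]
  · rw [hI, Set.encard_sdiff_singleton_add_one (top_mem_fareySet M N)]
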